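/- Let $\nu$ be an atomless measure on $\mathbb R$ (for instance Lebesgue measure) and let $p_0\ge 0$ be a probability density with respect to $\nu$. Suppose $L(\theta)=\int e^{\theta x}p_0(x)\,\nu(dx)$ is finite for all $\theta\in\Theta=(\underline\theta,\overline\theta)$, where $-\infty\le\underline\theta<0<\overline\theta\le\infty$. Put $\kappa=\log L$, $\mu=\kappa'$ and $p_\theta(x)=\exp(\theta x-\kappa(\theta))\,p_0(x)$ for $\theta\in\Theta$. Let $n\ge 1$, let $x_1,\dots,x_n\in\mathbb R$ satisfy $p_0(x_i)>0$, and let $\hat\pi$ be an NPMLE of the mixing distribution, i.e. a maximizer of $$\frac1n\sum_{i=1}^n\log\int_\Theta p_\theta(x_i)\,\pi(d\theta)$$ over all probability measures $\pi$ on $\Theta$. Fix $x_{\min}\le\min_i x_i$ and $x_{\max}\ge\max_i x_i$ in the range $\mu(\Theta)$, with $x_{\min}\le\mu(0)\le x_{\max}$, and set $\theta_{\min}=\mu^{-1}(x_{\min})$, $\theta_{\max}=\mu^{-1}(x_{\max})$, $r=\frac{\theta_{\max}-\theta_{\min}}2$, $a=\frac{x_{\max}-x_{\min}}2$, $x_0=\frac{x_{\max}+x_{\min}}2$.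 Then for each $\delta>0$ with $\delta<\frac15\min\{\theta_{\min}-\underline\theta,\ \overline\theta-\theta_{\max}\}$, the support of $\hat\pi$ is finite and $$|\operatorname{supp}(\hat\pi)|\le\frac{N_1}{\log\frac{2r+2\delta}{2r+\delta}},$$ where $$N_1=2\,(a+|\mu(0)|+|x_0|)\,(|\theta|_{\max}+2\delta)+\kappa_{\max}+\log\frac{|x|_{\max}+\frac1\delta}{\tau},$$ $$\tau=\max\{\mu(\theta_{\max}+\delta)-x_{\max},\ x_{\min}-\mu(\theta_{\min}-\delta)\},$$ $$|\theta|_{\max}=\max\{\theta_{\max},-\theta_{\min}\},\qquad |x|_{\max}=\max\{x_{\max},-x_{\min}\},\qquad \kappa_{\max}=\max\{\kappa(\theta_{\min}-3\delta),\kappa(\theta_{\max}+3\delta)\}.$$ -/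

import Mathlib

open MeasureTheory ProbabilityTheory

noncomputable section

namespace ExpFamily

/-- The probability law with density `p₀` with respect to the dominating measure `ν`. -/
def baseLaw (ν : Measure ℝ) (p₀ : ℝ → ℝ) : Measure ℝ :=
  ν.withDensity fun x => ENNReal.ofReal (p₀ x)

/-- The moment generating function `L(θ) = E_{X ∼ p₀}[exp(θ X)]`. -/
def L (ν : Measure ℝ) (p₀ : ℝ → ℝ) (θ : ℝ) : ℝ := mgf id (baseLaw ν p₀) θ

/-- The cumulant generating function `κ(θ) = log L(θ)`. -/
def kappa (ν : Measure ℝ) (p₀ : ℝ → ℝ) (θ : ℝ) : ℝ := Real.log (L ν p₀ θ)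

/-- The mean function `μ(θ) = κ'(θ)`. -/
def mean (ν : Measure ℝ) (p₀ : ℝ → ℝ) (θ : ℝ) : ℝ := deriv (kappa ν p₀) θ

/-- The member `p_θ(x) = exp(θ x - κ(θ)) p₀(x)` of the exponential family. -/
def density (ν : Measure ℝ) (p₀ : ℝ → ℝ) (θ x : ℝ) : ℝ :=
  Real.exp (θ * x - kappa ν p₀ θ) * p₀ x

/-- The open parameter interval with end points `θlo, θhi ∈ [-∞, ∞]`. -/
def paramSpace (θlo θhi : EReal) : Set ℝ := {θ : ℝ | θlo < (θ : EReal) ∧ (θ : EReal) < θhi}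

/-- The probability measures on the parameter set `Θ`, as measures on `ℝ` carried by `Θ`. -/
def mixingMeasures (Θ : Set ℝ) : Set (Measure ℝ) :=
  {π | IsProbabilityMeasure π ∧ π Θᶜ = 0}

/-- The mixture density `p_π(x) = ∫ p_θ(x) π(dθ)`. If `x` lies between two values of `μ = κ'` on
the parameter interval then `θ ↦ p_θ(x)` is bounded there, since `θ x - κ(θ)` is concave
and attains its maximum; so the integral is then a genuine one. -/
def mixtureDensity (ν : Measure ℝ) (p₀ : ℝ → ℝ) (π : Measure ℝ) (x : ℝ) : ℝ :=
  ∫ θ, density ν p₀ θ x ∂π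

/-- The normalized log-likelihood `(1/n) ∑ᵢ log p_π(xᵢ)` of a mixing measure `π`. -/
def logLik (ν : Measure ℝ) (p₀ : ℝ → ℝ) {n : ℕ} (x : Fin n → ℝ) (π : Measure ℝ) : ℝ :=
  (1 / (n : ℝ)) * ∑ i, Real.log (mixtureDensity ν p₀ π (x i))

/-- `π` is a nonparametric maximum likelihood estimator: it maximizes the log-likelihood over all
probability measures on the parameter set `Θ`. -/
def IsNPMLE (ν : Measure ℝ) (p₀ : ℝ → ℝ) (Θ : Set ℝ) {n : ℕ} (x : Fin n → ℝ)
    (π : Measure ℝ) : Prop :=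
  π ∈ mixingMeasures Θ ∧ IsMaxOn (logLik ν p₀ x) (mixingMeasures Θ) π

/-- The gap `τ = max {μ(θmax + δ) - xmax, xmin - μ(θmin - δ)}`. -/
def tau (ν : Measure ℝ) (p₀ : ℝ → ℝ) (xmin xmax θmin θmax δ : ℝ) : ℝ :=
  max (mean ν p₀ (θmax + δ) - xmax) (xmin - mean ν p₀ (θmin - δ))

/-- The quantity `N₁ = 2 (a + |μ(0)| + |x₀|) (|θ|_max + 2δ) + κ_max + log ((|x|_max + 1/δ) / τ)`. -/
def N₁ (ν : Measure ℝ) (p₀ : ℝ → ℝ) (xmin xmax θmin θmax δ : ℝ) : ℝ :=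
  let a := (xmax - xmin) / 2
  let x₀ := (xmax + xmin) / 2
  let θabs := max θmax (-θmin)
  let xabs := max xmax (-xmin)
  let κmax := max (kappa ν p₀ (θmin - 3 * δ)) (kappa ν p₀ (θmax + 3 * δ))
  2 * (a + |mean ν p₀ 0| + |x₀|) * (θabs + 2 * δ) + κmax
    + Real.log ((xabs + 1 / δ) / tau ν p₀ xmin xmax θmin θmax δ)

end ExpFamily

end

/-! The proof is real-variable. Let `P` be the law with density `p₀` and `L` its moment generating
function. The optimality conditions for the estimator `π` (`IsNPMLE.exists_weights`) give a finite
measure `∑ Wᵢ δ_{xᵢ}` on the observations whose Laplace transform `E θ = ∑ Wᵢ exp (θ xᵢ)` is at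
most `L` on `Θ`, with equality `π`-almost everywhere. Strict convexity of `κ` makes the inequality
strict outside `[θmin, θmax]`, so every support point lies in this interval (`support_subset`) and
there `E` and `L` agree together with their derivatives (`deriv_mgf_eq_sum`).

It remains to see that `L - E` cannot touch zero too often. Put `s = xmin` and
`h t = ∫ y exp (t y) d(P - ∑ Wᵢ δ_{xᵢ})`, where `y = x - s`. This function vanishes at every support
point. Choose an even number `m` of them as nodes. The divided difference of `h` at the nodes and
`θ = θmax + δ` equals `h θ / ∏ (θ - t)`, and it is also the integral of `y ψ y`, where `ψ` is the
divided difference of `t ↦ exp (t y)` (`exists_expSum_dividedDifference`). By parity `y ψ y ≤ 0` for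
`y ≤ 0`, and the observations sit in `y ≥ 0` with a minus sign, so only `P` on `y ≥ 0` counts; there
`ψ` grows when `θ` is moved to `θ' = θmax + 2δ`, whence
`h θ ≤ ∏ ((θ - t) / (θ' - t)) * ∫_{y ≥ 0} y exp (θ' y) dP`. Each ratio is at most
`(2r + δ) / (2r + 2δ)`, the integral is at most `exp (-s (θ' + δ)) L (θ' + δ) / (e δ)`, and
`h θ ≥ exp (-s θ) (μ θ - xmax) L θ`. Taking logarithms bounds `m log ((2r + 2δ) / (2r + δ)) + 1`
by `N₁`, if `τ` is the gap at the right end; reflection `x ↦ -x` treats the left end. The `1` gained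
from `y ≤ exp (δ y) / (e δ)` pays for the one support point that may have to be dropped to make `m`
even. -/

open MeasureTheory ProbabilityTheory

namespace ExpFamily

/-! ### Divided differences of exponentials -/

theorem nonneg_of_hasDerivAt_nonneg {f f' : ℝ → ℝ} (hf : ∀ y, HasDerivAt f (f' y) y)
    (h0 : f 0 = 0) (hf' : ∀ y, 0 ≤ y → 0 ≤ f' y) {y : ℝ} (hy : 0 ≤ y) : 0 ≤ f y := by
  have hmono : MonotoneOn f (Set.Ici 0) := by
    refine monotoneOn_of_deriv_nonneg (convex_Ici 0)
      (fun z _ => (hf z).continuousAt.continuousWithinAt)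
      (fun z _ => (hf z).differentiableAt.differentiableWithinAt) fun z hz => ?_
    rw [interior_Ici] at hz
    rw [(hf z).deriv]
    exact hf' z (le_of_lt hz)
  simpa [h0] using hmono Set.self_mem_Ici hy hy

theorem nonpos_of_hasDerivAt_nonneg {f f' : ℝ → ℝ} (hf : ∀ y, HasDerivAt f (f' y) y)
    (h0 : f 0 = 0) (hf' : ∀ y, y ≤ 0 → 0 ≤ f' y) {y : ℝ} (hy : y ≤ 0) : f y ≤ 0 := by
  have h := nonneg_of_hasDerivAt_nonneg (f := fun z => -f (-z)) (f' := fun z => f' (-z))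
    (fun z => ((hf (-z)).scomp z (hasDerivAt_neg z)).neg.congr_deriv (by simp))
    (by simp [h0]) (fun z hz => hf' (-z) (by linarith)) (y := -y) (by linarith)
  simp only [neg_neg] at h
  linarith

/-- The divided difference of `t ↦ exp (t * y)` at the nodes `T ∪ {θ}`, as a function `ψ` of `y`.
It is a combination of exponentials in which `exp (θ * y)` has coefficient `∏ (θ - t)⁻¹`; for
`y ≥ 0` it is nonnegative and increases when the node `θ` is moved to the right, and for `y ≤ 0`
it has the sign of `(-1) ^ #T`. Adding a node `t₀` replaces `ψ` by the solution `u` of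
`u' = t₀ u + ψ`, `u 0 = 0`, which makes all of these properties inductive. -/
theorem exists_expSum_dividedDifference (T : Finset ℝ) {θ θ' : ℝ} (hθ : θ ≤ θ')
    (hT : ∀ t ∈ T, t < θ) :
    ∃ c : ℝ → ℝ, ∀ y : ℝ,
      (0 ≤ y → 0 ≤ Real.exp (θ * y) / ∏ t ∈ T, (θ - t) + ∑ t ∈ T, c t * Real.exp (t * y)) ∧
      (0 ≤ y → Real.exp (θ * y) / ∏ t ∈ T, (θ - t) + ∑ t ∈ T, c t * Real.exp (t * y) ≤
        Real.exp (θ' * y) / ∏ t ∈ T, (θ' - t)) ∧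
      (y ≤ 0 → 0 ≤ (-1) ^ T.card *
        (Real.exp (θ * y) / ∏ t ∈ T, (θ - t) + ∑ t ∈ T, c t * Real.exp (t * y))) := by
  classical
  induction T using Finset.induction_on with
  | empty =>
    refine ⟨0, fun y => ⟨fun _ => ?_, fun hy => ?_, fun _ => ?_⟩⟩
    · simpa using (Real.exp_pos _).le
    · simpa using mul_le_mul_of_nonneg_right hθ hy
    · simpa using (Real.exp_pos _).le
  | insert t₀ T ht₀ ih =>
    obtain ⟨c, hc⟩ := ih fun t ht => hT t (Finset.mem_insert_of_mem ht)
    have ht₀θ : 0 < θ - t₀ := sub_pos.2 (hT t₀ (Finset.mem_insert_self _ _))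
    have ht₀θ' : 0 < θ' - t₀ := by linarith
    set p := ∏ t ∈ T, (θ - t) with hp
    set p' := ∏ t ∈ T, (θ' - t) with hp'
    have hne : ∀ t ∈ T, t - t₀ ≠ 0 := fun t ht h =>
      ht₀ (by rwa [← sub_eq_zero.1 h])
    -- `v y = exp (-t₀ y) u y`, where `u` is the divided difference with the node `t₀` added
    set v : ℝ → ℝ := fun y => (Real.exp ((θ - t₀) * y) - 1) / ((θ - t₀) * p) +
      ∑ t ∈ T, c t / (t - t₀) * (Real.exp ((t - t₀) * y) - 1) with hv
    have hexp : ∀ a y : ℝ, HasDerivAt (fun y => Real.exp (a * y)) (a * Real.exp (a * y)) y :=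
      fun a y => by simpa [mul_comm] using ((hasDerivAt_id y).const_mul a).exp
    have hv' : ∀ y, HasDerivAt v (Real.exp (-(t₀ * y)) *
        (Real.exp (θ * y) / p + ∑ t ∈ T, c t * Real.exp (t * y))) y := by
      intro y
      have hd := (((hexp (θ - t₀) y).sub_const 1).div_const ((θ - t₀) * p)).add
        (HasDerivAt.fun_sum fun t (_ : t ∈ T) =>
          ((hexp (t - t₀) y).sub_const 1).const_mul (c t / (t - t₀)))
      refine hd.congr_deriv ?_
      have he : ∀ a : ℝ, Real.exp ((a - t₀) * y) = Real.exp (-(t₀ * y)) * Real.exp (a * y) :=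
        fun a => by rw [← Real.exp_add]; ring_nf
      rw [mul_add, Finset.mul_sum]
      congr 1
      · rw [he, mul_div_mul_left _ _ ht₀θ.ne']; ring
      · refine Finset.sum_congr rfl fun t ht => ?_
        rw [he]
        have := hne t ht
        field_simp
    have hv0 : v 0 = 0 := by simp [hv]
    set c' : ℝ → ℝ := fun t => if t = t₀ then
      -(1 / ((θ - t₀) * p) + ∑ t ∈ T, c t / (t - t₀)) else c t / (t - t₀) with hc'
    have hu : ∀ y, Real.exp (θ * y) / ∏ t ∈ insert t₀ T, (θ - t) +
        ∑ t ∈ insert t₀ T, c' t * Real.exp (t * y) = Real.exp (t₀ * y) * v y := by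
      intro y
      have he : ∀ a : ℝ, Real.exp (a * y) = Real.exp (t₀ * y) * Real.exp ((a - t₀) * y) :=
        fun a => by rw [← Real.exp_add]; ring_nf
      have hsum : ∑ t ∈ T, c' t * Real.exp (t * y) =
          Real.exp (t₀ * y) * ∑ t ∈ T, c t / (t - t₀) * Real.exp ((t - t₀) * y) := by
        rw [Finset.mul_sum]
        refine Finset.sum_congr rfl fun t ht => ?_
        have : t ≠ t₀ := fun h => ht₀ (h ▸ ht)
        simp only [hc', this, if_false]
        rw [he t]; ring
      have hvy : v y = (Real.exp ((θ - t₀) * y) - 1) / ((θ - t₀) * p) +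
          (∑ t ∈ T, c t / (t - t₀) * Real.exp ((t - t₀) * y) - ∑ t ∈ T, c t / (t - t₀)) := by
        rw [← Finset.sum_sub_distrib]
        simp only [hv, mul_sub, mul_one]
      have hct₀ : c' t₀ = -(1 / ((θ - t₀) * p) + ∑ t ∈ T, c t / (t - t₀)) := if_pos rfl
      rw [Finset.prod_insert ht₀, Finset.sum_insert ht₀, hsum, ← hp, hvy, hct₀, he θ]
      ring
    refine ⟨c', fun y => ?_⟩
    rw [hu, Finset.prod_insert ht₀, ← hp', Finset.card_insert_of_notMem ht₀]
    refine ⟨fun hy => ?_, fun hy => ?_, fun hy => ?_⟩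
    · exact mul_nonneg (Real.exp_pos _).le (nonneg_of_hasDerivAt_nonneg hv' hv0
        (fun z hz => mul_nonneg (Real.exp_pos _).le ((hc z).1 hz)) hy)
    · have hp'pos : 0 < p' := Finset.prod_pos fun t ht => by
        have := hT t (Finset.mem_insert_of_mem ht); linarith
      have h := nonneg_of_hasDerivAt_nonneg
        (f := fun z => (Real.exp ((θ' - t₀) * z) - 1) / ((θ' - t₀) * p') - v z)
        (fun z => (((hexp (θ' - t₀) z).sub_const 1).div_const ((θ' - t₀) * p')).sub (hv' z))
        (by simp [hv0]) (fun z hz => ?_) hy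
      · have hle : v y ≤ Real.exp ((θ' - t₀) * y) / ((θ' - t₀) * p') := by
          have : 0 ≤ 1 / ((θ' - t₀) * p') := by positivity
          simp only [sub_div] at h
          linarith
        calc Real.exp (t₀ * y) * v y
            ≤ Real.exp (t₀ * y) * (Real.exp ((θ' - t₀) * y) / ((θ' - t₀) * p')) := by gcongr
          _ = Real.exp (θ' * y) / ((θ' - t₀) * p') := by
              rw [← mul_div_assoc, ← Real.exp_add]; ring_nf
      · rw [mul_div_mul_left _ _ ht₀θ'.ne', sub_nonneg]
        calc _ ≤ Real.exp (-(t₀ * z)) * (Real.exp (θ' * z) / p') := by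
              gcongr; exact (hc z).2.1 hz
          _ = Real.exp ((θ' - t₀) * z) / p' := by
              rw [← mul_div_assoc, ← Real.exp_add]; ring_nf
    · have h := nonpos_of_hasDerivAt_nonneg (f := fun z => (-1) ^ T.card * v z)
        (fun z => (hv' z).const_mul _) (by simp [hv0]) (fun z hz => ?_) hy
      · have := mul_nonneg (Real.exp_pos (t₀ * y)).le (neg_nonneg.2 h)
        calc (0 : ℝ) ≤ _ := this
          _ = _ := by ring
      · have := mul_nonneg (Real.exp_pos (-(t₀ * z))).le ((hc z).2.2 hz)
        calc (0 : ℝ) ≤ _ := this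
          _ = _ := by ring

/-! ### Comparison of Laplace transforms that touch at many points -/

theorem mul_exp_le {δ : ℝ} (hδ : 0 < δ) (θ y : ℝ) :
    y * Real.exp (θ * y) ≤ Real.exp ((θ + δ) * y) / (Real.exp 1 * δ) := by
  rw [le_div_iff₀ (by positivity)]
  have h := Real.add_one_le_exp (δ * y - 1)
  have h2 : Real.exp ((θ + δ) * y) = Real.exp 1 * Real.exp (θ * y) * Real.exp (δ * y - 1) := by
    rw [← Real.exp_add, ← Real.exp_add]; ring_nf
  rw [h2]
  calc y * Real.exp (θ * y) * (Real.exp 1 * δ)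
      = Real.exp 1 * Real.exp (θ * y) * (δ * y - 1 + 1) := by ring
    _ ≤ _ := by gcongr

/-- Suppose `h t = E[Y exp (t Y)] - ∑ Wᵢ ηᵢ exp (t ηᵢ)` vanishes on a set `T` of even size, the atoms
`ηᵢ` being nonnegative. Then `h θ` is bounded by a product of ratios of distances to the nodes. On
`y ≤ 0` the function `y ψ y`, with `ψ` the divided difference, is not positive because the number
of nodes is even; the atoms, which enter with a minus sign, lie in `y ≥ 0`, where it is not
negative. So only the part of the law of `Y` on `y ≥ 0` contributes to an upper bound, and there
`ψ` may be compared with its value for a node `θ'` further to the right. -/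
theorem integral_sub_sum_le_prod_mul {Ω : Type*} {mΩ : MeasurableSpace Ω} {P : Measure Ω}
    {Y : Ω → ℝ} {ι : Type*} [Fintype ι] {W η : ι → ℝ} (hW : ∀ i, 0 ≤ W i) (hη : ∀ i, 0 ≤ η i)
    {T : Finset ℝ} (hT : Even T.card) {θ θ' δ : ℝ} (hθ : θ ≤ θ') (hTθ : ∀ t ∈ T, t < θ)
    (hδ : 0 < δ) (hint : Integrable (fun ω => Y ω * Real.exp (θ * Y ω)) P)
    (hintT : ∀ t ∈ T, Integrable (fun ω => Y ω * Real.exp (t * Y ω)) P)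
    (hint' : Integrable (fun ω => Real.exp ((θ' + δ) * Y ω)) P)
    (hzero : ∀ t ∈ T, ∫ ω, Y ω * Real.exp (t * Y ω) ∂P =
      ∑ i, W i * (η i * Real.exp (t * η i))) :
    ∫ ω, Y ω * Real.exp (θ * Y ω) ∂P - ∑ i, W i * (η i * Real.exp (θ * η i)) ≤
      (∏ t ∈ T, (θ - t) / (θ' - t)) * (mgf Y P (θ' + δ) / (Real.exp 1 * δ)) := by
  obtain ⟨c, hc⟩ := exists_expSum_dividedDifference T hθ hTθ
  set p := ∏ t ∈ T, (θ - t) with hp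
  set p' := ∏ t ∈ T, (θ' - t) with hp'
  have hppos : 0 < p := Finset.prod_pos fun t ht => sub_pos.2 (hTθ t ht)
  have hp'pos : 0 < p' := Finset.prod_pos fun t ht => sub_pos.2 ((hTθ t ht).trans_le hθ)
  set ψ : ℝ → ℝ := fun y => Real.exp (θ * y) / p + ∑ t ∈ T, c t * Real.exp (t * y) with hψ
  have hmul : ∀ y, y * ψ y = p⁻¹ * (y * Real.exp (θ * y)) +
      ∑ t ∈ T, c t * (y * Real.exp (t * y)) := fun y => by
    simp only [hψ, mul_add, Finset.mul_sum]
    congr 1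
    · ring
    · exact Finset.sum_congr rfl fun t _ => by ring
  have hI1 : Integrable (fun ω => p⁻¹ * (Y ω * Real.exp (θ * Y ω))) P := hint.const_mul _
  have hI2 : ∀ t ∈ T, Integrable (fun ω => c t * (Y ω * Real.exp (t * Y ω))) P :=
    fun t ht => (hintT t ht).const_mul _
  have hIψ : Integrable (fun ω => Y ω * ψ (Y ω)) P := by
    simp only [hmul]
    exact hI1.add (integrable_finsetSum _ hI2)
  -- the nodes contribute nothing to the integral of `y ψ y` against the difference of the measures
  have hkey : ∫ ω, Y ω * ψ (Y ω) ∂P - ∑ i, W i * (η i * ψ (η i)) =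
      p⁻¹ * (∫ ω, Y ω * Real.exp (θ * Y ω) ∂P - ∑ i, W i * (η i * Real.exp (θ * η i))) := by
    simp only [hmul]
    rw [integral_add hI1 (integrable_finsetSum _ hI2), integral_finsetSum _ hI2]
    simp only [integral_const_mul, mul_add, Finset.sum_add_distrib, Finset.mul_sum]
    rw [Finset.sum_comm (s := Finset.univ)]
    have h1 : ∑ t ∈ T, c t * ∫ ω, Y ω * Real.exp (t * Y ω) ∂P =
        ∑ t ∈ T, ∑ i, W i * (c t * (η i * Real.exp (t * η i))) := by
      refine Finset.sum_congr rfl fun t ht => ?_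
      rw [hzero t ht, Finset.mul_sum]
      exact Finset.sum_congr rfl fun i _ => by ring
    have h2 : ∑ i, W i * (p⁻¹ * (η i * Real.exp (θ * η i))) =
        p⁻¹ * ∑ i, W i * (η i * Real.exp (θ * η i)) := by
      rw [Finset.mul_sum]
      exact Finset.sum_congr rfl fun i _ => by ring
    rw [h1, h2]
    simp only [mul_sub, Finset.mul_sum]
    ring
  have hsum : 0 ≤ ∑ i, W i * (η i * ψ (η i)) := Finset.sum_nonneg fun i _ =>
    mul_nonneg (hW i) (mul_nonneg (hη i) ((hc (η i)).1 (hη i)))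
  have hle : ∫ ω, Y ω * ψ (Y ω) ∂P ≤ p'⁻¹ * (mgf Y P (θ' + δ) / (Real.exp 1 * δ)) := by
    rw [mgf, ← integral_div, ← integral_const_mul]
    refine integral_mono hIψ ((hint'.div_const _).const_mul _) fun ω => ?_
    have hpos : 0 ≤ p'⁻¹ * (Real.exp ((θ' + δ) * Y ω) / (Real.exp 1 * δ)) := by positivity
    rcases le_total 0 (Y ω) with hy | hy
    · calc Y ω * ψ (Y ω) ≤ Y ω * (Real.exp (θ' * Y ω) / p') :=
            mul_le_mul_of_nonneg_left ((hc _).2.1 hy) hy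
        _ = p'⁻¹ * (Y ω * Real.exp (θ' * Y ω)) := by ring
        _ ≤ _ := mul_le_mul_of_nonneg_left (mul_exp_le hδ _ _) (by positivity)
    · have hψ0 := (hc (Y ω)).2.2 hy
      rw [hT.neg_one_pow, one_mul] at hψ0
      exact (mul_nonpos_of_nonpos_of_nonneg hy hψ0).trans hpos
  rw [Finset.prod_div_distrib, ← hp, ← hp']
  have h := hkey ▸ (sub_le_self _ hsum).trans hle
  calc _ = p * (p⁻¹ * (∫ ω, Y ω * Real.exp (θ * Y ω) ∂P -
        ∑ i, W i * (η i * Real.exp (θ * η i)))) := by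
        rw [mul_inv_cancel_left₀ hppos.ne']
    _ ≤ p * (p'⁻¹ * (mgf Y P (θ' + δ) / (Real.exp 1 * δ))) := by gcongr
    _ = _ := by ring

theorem integrable_mul_exp {Ω : Type*} {mΩ : MeasurableSpace Ω} {P : Measure Ω} {X : Ω → ℝ}
    {t : ℝ} (ht : t ∈ interior (integrableExpSet X P)) :
    Integrable (fun ω => X ω * Real.exp (t * X ω)) P := by
  simpa using integrable_pow_mul_exp_of_mem_interior_integrableExpSet ht 1

/-- If the Laplace transform `E` of `∑ Wᵢ δ_{ξᵢ}` agrees to first order with `mgf X P` at the points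
of `T`, an even number of points of `[α, β]`, then `exp (-s t) * (mgf X P - E)` has a derivative at
`β + δ` that is geometrically small in the number of points. That derivative is bounded below by
`exp (-s t) * (mgf' - b * mgf)`, because `E ≤ mgf` at `β + δ` and the atoms lie in `[s, b]`. -/
theorem pow_mul_gap_le {Ω : Type*} {mΩ : MeasurableSpace Ω} {P : Measure Ω}
    {X : Ω → ℝ} {ι : Type*} [Fintype ι] {W ξ : ι → ℝ} {s b : ℝ} (hW : ∀ i, 0 ≤ W i)
    (hs : ∀ i, s ≤ ξ i) (hb : ∀ i, ξ i ≤ b) (hsb : s ≤ b)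
    {T : Finset ℝ} (hT : Even T.card) {α β δ : ℝ} (hαβ : α ≤ β) (hTmem : ∀ t ∈ T, t ∈ Set.Icc α β)
    (hδ : 0 < δ) (hint : ∀ t ∈ Set.Icc α (β + 3 * δ), t ∈ interior (integrableExpSet X P))
    (h0 : ∀ t ∈ T, mgf X P t = ∑ i, W i * Real.exp (t * ξ i))
    (h1 : ∀ t ∈ T, deriv (mgf X P) t = ∑ i, W i * (ξ i * Real.exp (t * ξ i)))
    (hle : ∑ i, W i * Real.exp ((β + δ) * ξ i) ≤ mgf X P (β + δ)) :
    ((β - α + 2 * δ) / (β - α + δ)) ^ T.card *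
        (deriv (mgf X P) (β + δ) - b * mgf X P (β + δ)) ≤
      Real.exp (-s * (2 * δ)) * mgf X P (β + 3 * δ) / (Real.exp 1 * δ) := by
  have hmemT : ∀ t ∈ T, t ∈ interior (integrableExpSet X P) := fun t ht =>
    hint t ⟨(hTmem t ht).1, by linarith [(hTmem t ht).2]⟩
  have hmemθ : β + δ ∈ interior (integrableExpSet X P) := hint _ ⟨by linarith, by linarith⟩
  have hmemθ' : β + 3 * δ ∈ interior (integrableExpSet X P) := hint _ ⟨by linarith, le_rfl⟩
  -- pass to the variable `X - s`, for which all the atoms are nonnegative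
  have hshift : ∀ t x : ℝ, (x - s) * Real.exp (t * (x - s)) =
      Real.exp (-(t * s)) * (x * Real.exp (t * x) - s * Real.exp (t * x)) := fun t x => by
    rw [show t * (x - s) = -(t * s) + t * x by ring, Real.exp_add]; ring
  have hexpI : ∀ {t}, t ∈ interior (integrableExpSet X P) →
      Integrable (fun ω => Real.exp (t * X ω)) P := fun ht =>
    interior_subset (s := integrableExpSet X P) ht
  have hintY : ∀ {t}, t ∈ interior (integrableExpSet X P) →
      Integrable (fun ω => (X ω - s) * Real.exp (t * (X ω - s))) P := fun ht => by
    simp only [hshift]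
    exact ((integrable_mul_exp ht).sub ((hexpI ht).const_mul s)).const_mul _
  have hvalY : ∀ {t}, t ∈ interior (integrableExpSet X P) →
      ∫ ω, (X ω - s) * Real.exp (t * (X ω - s)) ∂P =
        Real.exp (-(t * s)) * (deriv (mgf X P) t - s * mgf X P t) := fun {t} ht => by
    simp only [hshift]
    rw [integral_const_mul, integral_sub (integrable_mul_exp ht) ((hexpI ht).const_mul s),
      integral_const_mul, deriv_mgf ht]
    rfl
  have hsumY : ∀ t, ∑ i, W i * ((ξ i - s) * Real.exp (t * (ξ i - s))) =
      Real.exp (-(t * s)) * (∑ i, W i * (ξ i * Real.exp (t * ξ i)) -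
        s * ∑ i, W i * Real.exp (t * ξ i)) := fun t => by
    simp only [hshift, Finset.mul_sum, ← Finset.sum_sub_distrib]
    exact Finset.sum_congr rfl fun i _ => by ring
  have hexpY : ∀ t x : ℝ, Real.exp (t * (x - s)) = Real.exp (-(t * s)) * Real.exp (t * x) :=
    fun t x => by rw [← Real.exp_add]; ring_nf
  have hmain := integral_sub_sum_le_prod_mul (P := P) (Y := fun ω => X ω - s) (W := W)
    (η := fun i => ξ i - s) hW (fun i => sub_nonneg.2 (hs i)) hT (θ := β + δ) (θ' := β + 2 * δ)
    (δ := δ) (by linarith) (fun t ht => by linarith [(hTmem t ht).2]) hδ (hintY hmemθ)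
    (fun t ht => hintY (hmemT t ht))
    (by
      simp only [hexpY]
      rw [show β + 2 * δ + δ = β + 3 * δ by ring]
      exact (hexpI hmemθ').const_mul _)
    (fun t ht => by rw [hvalY (hmemT t ht), hsumY, h0 t ht, h1 t ht])
  have hmgfY : mgf (fun ω => X ω - s) P (β + 2 * δ + δ) =
      Real.exp (-((β + 3 * δ) * s)) * mgf X P (β + 3 * δ) := by
    rw [mgf, mgf, ← integral_const_mul, show β + 2 * δ + δ = β + 3 * δ by ring]
    exact integral_congr_ae (.of_forall fun ω => hexpY _ _)
  rw [hvalY hmemθ, hsumY, hmgfY] at hmain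
  have hD : 0 < β - α + δ := by linarith
  set R := (β - α + 2 * δ) / (β - α + δ) with hR
  have hRpos : 0 < R := by positivity
  have hprod : ∏ t ∈ T, (β + δ - t) / (β + 2 * δ - t) ≤ (R ^ T.card)⁻¹ := by
    rw [← inv_pow, ← Finset.prod_const]
    refine Finset.prod_le_prod (fun t ht => ?_) fun t ht => ?_
    · have := (hTmem t ht).2
      exact div_nonneg (by linarith) (by linarith)
    · have h2 := (hTmem t ht).2
      have h3 := (hTmem t ht).1
      rw [hR, inv_div, div_le_div_iff₀ (by linarith) (by linarith)]
      nlinarith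
  have hlow : deriv (mgf X P) (β + δ) - b * mgf X P (β + δ) ≤
      (deriv (mgf X P) (β + δ) - s * mgf X P (β + δ)) -
        (∑ i, W i * (ξ i * Real.exp ((β + δ) * ξ i)) -
          s * ∑ i, W i * Real.exp ((β + δ) * ξ i)) := by
    have h2 : ∑ i, W i * (ξ i * Real.exp ((β + δ) * ξ i)) ≤
        b * ∑ i, W i * Real.exp ((β + δ) * ξ i) := by
      rw [Finset.mul_sum]
      refine Finset.sum_le_sum fun i _ => ?_
      have := mul_le_mul_of_nonneg_right (hb i)
        (mul_nonneg (hW i) (Real.exp_pos ((β + δ) * ξ i)).le)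
      linarith
    nlinarith [mul_le_mul_of_nonneg_left hle (sub_nonneg.2 hsb)]
  have hK : 0 ≤ Real.exp (-((β + 3 * δ) * s)) * mgf X P (β + 3 * δ) / (Real.exp 1 * δ) := by
    have : 0 ≤ mgf X P (β + 3 * δ) := mgf_nonneg
    positivity
  have h3 : Real.exp (-((β + δ) * s)) * (deriv (mgf X P) (β + δ) - b * mgf X P (β + δ)) ≤
      (R ^ T.card)⁻¹ *
        (Real.exp (-((β + 3 * δ) * s)) * mgf X P (β + 3 * δ) / (Real.exp 1 * δ)) := by
    refine le_trans ?_ (hmain.trans (mul_le_mul_of_nonneg_right hprod hK))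
    rw [← mul_sub]
    exact mul_le_mul_of_nonneg_left hlow (Real.exp_pos _).le
  have h4 : R ^ T.card * (R ^ T.card)⁻¹ = 1 := mul_inv_cancel₀ (by positivity)
  have h5 : Real.exp ((β + δ) * s) * Real.exp (-((β + δ) * s)) = 1 := by
    rw [← Real.exp_add]; simp
  have h6 : Real.exp ((β + δ) * s) * Real.exp (-((β + 3 * δ) * s)) = Real.exp (-s * (2 * δ)) := by
    rw [← Real.exp_add]; ring_nf
  have h7 := mul_le_mul_of_nonneg_left h3
    (show 0 ≤ R ^ T.card * Real.exp ((β + δ) * s) by positivity)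
  calc _ = R ^ T.card * (deriv (mgf X P) (β + δ) - b * mgf X P (β + δ)) *
        (Real.exp ((β + δ) * s) * Real.exp (-((β + δ) * s))) := by rw [h5, mul_one]
    _ = _ := by ring
    _ ≤ _ := h7
    _ = (R ^ T.card * (R ^ T.card)⁻¹) * ((Real.exp ((β + δ) * s) *
        Real.exp (-((β + 3 * δ) * s))) * mgf X P (β + 3 * δ) / (Real.exp 1 * δ)) := by ring
    _ = _ := by rw [h4, h6, one_mul]

/-- The logarithmic form of `pow_mul_gap_le`. The summand `1` comes from the factor `exp 1` in
`y ≤ exp (δ * y) / (exp 1 * δ)`. -/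
theorem card_mul_log_add_one_le {Ω : Type*} {mΩ : MeasurableSpace Ω} {P : Measure Ω} [NeZero P]
    {X : Ω → ℝ} {ι : Type*} [Fintype ι] {W ξ : ι → ℝ} {s b : ℝ} (hW : ∀ i, 0 ≤ W i)
    (hs : ∀ i, s ≤ ξ i) (hb : ∀ i, ξ i ≤ b) (hsb : s ≤ b)
    {T : Finset ℝ} (hT : Even T.card) {α β δ : ℝ} (hαβ : α ≤ β) (hTmem : ∀ t ∈ T, t ∈ Set.Icc α β)
    (hδ : 0 < δ) (hint : ∀ t ∈ Set.Icc α (β + 3 * δ), t ∈ interior (integrableExpSet X P))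
    (h0 : ∀ t ∈ T, mgf X P t = ∑ i, W i * Real.exp (t * ξ i))
    (h1 : ∀ t ∈ T, deriv (mgf X P) t = ∑ i, W i * (ξ i * Real.exp (t * ξ i)))
    (hle : ∑ i, W i * Real.exp ((β + δ) * ξ i) ≤ mgf X P (β + δ))
    (hgap : b < deriv (cgf X P) (β + δ)) :
    T.card * Real.log ((β - α + 2 * δ) / (β - α + δ)) + 1 ≤
      Real.log (1 / δ / (deriv (cgf X P) (β + δ) - b)) + cgf X P (β + 3 * δ) -
        cgf X P (β + δ) - s * (2 * δ) := by
  have hmemθ : β + δ ∈ interior (integrableExpSet X P) := hint _ ⟨by linarith, by linarith⟩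
  have hmemθ' : β + 3 * δ ∈ interior (integrableExpSet X P) := hint _ ⟨by linarith, le_rfl⟩
  have hpos : 0 < mgf X P (β + δ) :=
    mgf_pos' (NeZero.ne P) (interior_subset (s := integrableExpSet X P) hmemθ)
  have hpos' : 0 < mgf X P (β + 3 * δ) :=
    mgf_pos' (NeZero.ne P) (interior_subset (s := integrableExpSet X P) hmemθ')
  have hderiv : deriv (mgf X P) (β + δ) = deriv (cgf X P) (β + δ) * mgf X P (β + δ) := by
    rw [deriv_cgf hmemθ, deriv_mgf hmemθ, div_mul_cancel₀ _ hpos.ne']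
  have h := pow_mul_gap_le hW hs hb hsb hT hαβ hTmem hδ hint h0 h1 hle
  rw [hderiv, ← sub_mul] at h
  have hgap' := sub_pos.2 hgap
  have hR : 0 < (β - α + 2 * δ) / (β - α + δ) := div_pos (by linarith) (by linarith)
  have hlog := Real.log_le_log (by positivity) h
  rw [Real.log_mul (by positivity) (by positivity), Real.log_mul hgap'.ne' hpos.ne',
    Real.log_div (by positivity) (by positivity), Real.log_mul (by positivity) hpos'.ne',
    Real.log_mul (by positivity) hδ.ne', Real.log_exp, Real.log_exp, Real.log_pow] at hlog
  rw [Real.log_div (by positivity) hgap'.ne', Real.log_div one_ne_zero hδ.ne', Real.log_one, cgf,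
    cgf]
  linarith

/-! ### Strict convexity of the cumulant generating function -/

/-- Strict convexity of `κ` for an atomless law, as the strict tangent line inequality: integrate
`1 + z < exp z` at `z = (v - u) * (x - κ' u)` against the tilted law. -/
theorem cgf_tangent_lt {P : Measure ℝ} [NullSingletonClass P] [NeZero P] {u v : ℝ}
    (hu : u ∈ interior (integrableExpSet id P)) (hv : v ∈ integrableExpSet id P) (huv : u ≠ v) :
    cgf id P u + deriv (cgf id P) u * (v - u) < cgf id P v := by
  set m := deriv (cgf id P) u with hm
  have huI : Integrable (fun x : ℝ => Real.exp (u * x)) P :=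
    interior_subset (s := integrableExpSet id P) hu
  have hvI : Integrable (fun x : ℝ => Real.exp (v * x)) P := hv
  have hposu : 0 < mgf id P u := mgf_pos' (NeZero.ne P) huI
  have hposv : 0 < mgf id P v := mgf_pos' (NeZero.ne P) hvI
  have hmean : ∫ x, x * Real.exp (u * x) ∂P = m * mgf id P u := by
    rw [hm, deriv_cgf hu, div_mul_cancel₀ _ hposu.ne']; rfl
  have hxI : Integrable (fun x : ℝ => x * Real.exp (u * x)) P := integrable_mul_exp hu
  set d : ℝ → ℝ := fun x => Real.exp (v * x) - Real.exp ((v - u) * m) *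
    ((v - u) * (x * Real.exp (u * x)) + (1 - (v - u) * m) * Real.exp (u * x)) with hd
  have hdx : ∀ x, d x = Real.exp ((v - u) * m) * Real.exp (u * x) *
      (Real.exp ((v - u) * (x - m)) - ((v - u) * (x - m) + 1)) := fun x => by
    have : Real.exp (v * x) =
        Real.exp ((v - u) * m) * Real.exp (u * x) * Real.exp ((v - u) * (x - m)) := by
      rw [← Real.exp_add, ← Real.exp_add]; ring_nf
    simp only [hd, this]; ring
  have hdI2 : Integrable (fun x : ℝ => (v - u) * (x * Real.exp (u * x)) +
      (1 - (v - u) * m) * Real.exp (u * x)) P := (hxI.const_mul _).add (huI.const_mul _)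
  have hdI : Integrable d P := hvI.sub (hdI2.const_mul _)
  have hd0 : 0 ≤ d := fun x => by
    rw [hdx]
    exact mul_nonneg (by positivity) (sub_nonneg.2 (Real.add_one_le_exp _))
  have hsupp : {m}ᶜ ⊆ Function.support d := fun x hx => by
    have hne : (v - u) * (x - m) ≠ 0 := mul_ne_zero (sub_ne_zero.2 huv.symm) (sub_ne_zero.2 hx)
    rw [Function.mem_support, hdx]
    exact (mul_pos (by positivity) (sub_pos.2 (Real.add_one_lt_exp hne))).ne'
  have hdpos : 0 < ∫ x, d x ∂P := by
    rw [integral_pos_iff_support_of_nonneg hd0 hdI]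
    refine lt_of_lt_of_le ?_ (measure_mono hsupp)
    have h := measure_univ_le_add_compl (μ := P) {m}
    rw [measure_singleton, zero_add] at h
    exact (Measure.measure_univ_pos.2 (NeZero.ne P)).trans_le h
  have hint : ∫ x, d x ∂P = mgf id P v - Real.exp ((v - u) * m) * mgf id P u := by
    simp only [hd]
    rw [integral_sub hvI (hdI2.const_mul _), integral_const_mul,
      integral_add (hxI.const_mul _) (huI.const_mul _), integral_const_mul, integral_const_mul,
      hmean]
    change mgf id P v - Real.exp ((v - u) * m) * ((v - u) * (m * mgf id P u) +
      (1 - (v - u) * m) * mgf id P u) = _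
    ring
  rw [hint, sub_pos] at hdpos
  have h := Real.log_lt_log (by positivity) hdpos
  rw [Real.log_mul (by positivity) hposu.ne', Real.log_exp] at h
  rw [cgf, cgf]
  linarith

theorem deriv_cgf_lt {P : Measure ℝ} [NullSingletonClass P] [NeZero P] {u v : ℝ}
    (hu : u ∈ interior (integrableExpSet id P)) (hv : v ∈ interior (integrableExpSet id P))
    (huv : u < v) : deriv (cgf id P) u < deriv (cgf id P) v := by
  have h1 := cgf_tangent_lt hu (interior_subset hv) huv.ne
  have h2 := cgf_tangent_lt hv (interior_subset hu) huv.ne'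
  nlinarith

/-! ### The parameter interval and mixture densities -/

theorem isOpen_paramSpace (θlo θhi : EReal) : IsOpen (paramSpace θlo θhi) :=
  isOpen_Ioo.preimage continuous_coe_real_ereal

theorem paramSpace_subset_interior {ν : Measure ℝ} {p₀ : ℝ → ℝ} {θlo θhi : EReal}
    (hL : ∀ θ ∈ paramSpace θlo θhi,
      Integrable (fun x : ℝ => Real.exp (θ * x)) (baseLaw ν p₀)) :
    paramSpace θlo θhi ⊆ interior (integrableExpSet id (baseLaw ν p₀)) :=
  interior_maximal hL (isOpen_paramSpace θlo θhi)

theorem mem_paramSpace_of_mem_Icc {θlo θhi : EReal} {a b t : ℝ} (ha : a ∈ paramSpace θlo θhi)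
    (hb : b ∈ paramSpace θlo θhi) (ht : t ∈ Set.Icc a b) : t ∈ paramSpace θlo θhi :=
  ⟨ha.1.trans_le (EReal.coe_le_coe_iff.2 ht.1), (EReal.coe_le_coe_iff.2 ht.2).trans_lt hb.2⟩

/-- A linear function whose slope lies between two values of `κ'` stays within a bounded distance
above `κ`, because both tangent lines are below `κ`. -/
theorem exists_forall_mul_sub_cgf_le {P : Measure ℝ} [NullSingletonClass P] [NeZero P] {u v x : ℝ}
    (hu : u ∈ interior (integrableExpSet id P)) (hv : v ∈ interior (integrableExpSet id P))
    (hux : deriv (cgf id P) u ≤ x) (hxv : x ≤ deriv (cgf id P) v) :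
    ∃ C, ∀ θ ∈ integrableExpSet id P, θ * x - cgf id P θ ≤ C := by
  have key : ∀ {w}, w ∈ interior (integrableExpSet id P) → ∀ θ ∈ integrableExpSet id P,
      cgf id P w + deriv (cgf id P) w * (θ - w) ≤ cgf id P θ := fun {w} hw θ hθ => by
    rcases eq_or_ne w θ with rfl | h
    · simp
    · exact (cgf_tangent_lt hw hθ h).le
  refine ⟨max (deriv (cgf id P) u * u - cgf id P u) (deriv (cgf id P) v * v - cgf id P v),
    fun θ hθ => ?_⟩
  have h1 := key hu θ hθ
  have h2 := key hv θ hθ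
  rcases le_total 0 θ with h | h
  · refine le_trans ?_ (le_max_right _ _)
    nlinarith [mul_le_mul_of_nonneg_left hxv h]
  · refine le_trans ?_ (le_max_left _ _)
    nlinarith [mul_le_mul_of_nonpos_left hux h]

theorem continuousOn_kappa {ν : Measure ℝ} {p₀ : ℝ → ℝ} :
    ContinuousOn (kappa ν p₀) (interior (integrableExpSet id (baseLaw ν p₀))) :=
  analyticOnNhd_cgf.continuousOn

theorem integrable_density {ν : Measure ℝ} {p₀ : ℝ → ℝ} {Θ : Set ℝ} (hΘ : IsOpen Θ)
    (hΘint : Θ ⊆ interior (integrableExpSet id (baseLaw ν p₀))) {x C : ℝ} (hx : 0 ≤ p₀ x)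
    (hC : ∀ θ ∈ integrableExpSet id (baseLaw ν p₀), θ * x - cgf id (baseLaw ν p₀) θ ≤ C)
    {π : Measure ℝ} (hπ : π ∈ mixingMeasures Θ) :
    Integrable (fun θ => density ν p₀ θ x) π := by
  have := hπ.1
  have hae : ∀ᵐ θ ∂π, θ ∈ Θ := hπ.2
  have hrestr : π.restrict Θ = π := Measure.restrict_eq_self_of_ae_mem hae
  have hcont : ContinuousOn (fun θ => density ν p₀ θ x) Θ :=
    ((continuousOn_id.mul continuousOn_const).sub
      (continuousOn_kappa.mono hΘint)).rexp.mul continuousOn_const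
  refine Integrable.of_bound (C := Real.exp C * p₀ x)
    (hrestr ▸ hcont.aestronglyMeasurable hΘ.measurableSet) ?_
  filter_upwards [hae] with θ hθ
  rw [density, Real.norm_of_nonneg (by positivity)]
  have := hC θ (interior_subset (hΘint hθ))
  gcongr
  exact this

theorem mixtureDensity_pos {ν : Measure ℝ} {p₀ : ℝ → ℝ} {x : ℝ} (hx : 0 < p₀ x)
    {π : Measure ℝ} [IsProbabilityMeasure π] (hint : Integrable (fun θ => density ν p₀ θ x) π) :
    0 < mixtureDensity ν p₀ π x := by
  have hpos : ∀ θ, 0 < density ν p₀ θ x := fun θ => mul_pos (Real.exp_pos _) hx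
  rw [mixtureDensity, integral_pos_iff_support_of_nonneg (fun θ => (hpos θ).le) hint,
    Function.support_eq_univ fun θ => (hpos θ).ne']
  simp

/-! ### Optimality conditions for the NPMLE -/

/-- The first-order condition: the directional derivative of the log-likelihood at a maximizer, in
the direction of a point mass, is not positive. -/
theorem IsNPMLE.sum_density_div_le {ν : Measure ℝ} {p₀ : ℝ → ℝ} {Θ : Set ℝ} {n : ℕ} (hn : 0 < n)
    {x : Fin n → ℝ} (hx : ∀ i, 0 < p₀ (x i)) {π : Measure ℝ} (hπ : IsNPMLE ν p₀ Θ x π)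
    (hint : ∀ i, Integrable (fun θ => density ν p₀ θ (x i)) π) {θ : ℝ} (hθ : θ ∈ Θ) :
    ∑ i, density ν p₀ θ (x i) / mixtureDensity ν p₀ π (x i) ≤ n := by
  have := hπ.1.1
  set f : Fin n → ℝ := fun i => mixtureDensity ν p₀ π (x i) with hf
  set g : Fin n → ℝ := fun i => density ν p₀ θ (x i) with hg
  have hfpos : ∀ i, 0 < f i := fun i => mixtureDensity_pos (hx i) (hint i)
  set φ : ℝ → ℝ := fun t => ∑ i, Real.log (f i + t * (g i - f i)) with hφ
  have hle : ∀ t ∈ Set.Ioo (0 : ℝ) 1, φ t ≤ φ 0 := by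
    intro t ht
    -- the mixture `(1 - t) π + t δ_θ` is an admissible competitor
    set ρ : Measure ℝ := ENNReal.ofReal (1 - t) • π + ENNReal.ofReal t • Measure.dirac θ with hρ
    have hρmem : ρ ∈ mixingMeasures Θ := by
      refine ⟨⟨?_⟩, ?_⟩
      · simp only [hρ, Measure.add_apply, Measure.smul_apply, measure_univ, smul_eq_mul, mul_one]
        rw [← ENNReal.ofReal_add (by linarith [ht.2]) ht.1.le]
        simp
      · have h1 : Measure.dirac θ Θᶜ = 0 := by
          rw [← nonpos_iff_eq_zero]
          refine (measure_mono (Set.compl_subset_compl.2 (Set.singleton_subset_iff.2 hθ))).trans ?_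
          simp
        simp [hρ, hπ.1.2, h1]
    have hmix : ∀ i, mixtureDensity ν p₀ ρ (x i) = f i + t * (g i - f i) := fun i => by
      have hd : Integrable (fun θ => density ν p₀ θ (x i)) (Measure.dirac θ) :=
        integrable_dirac (by simp)
      rw [mixtureDensity, hρ, integral_add_measure ((hint i).smul_measure ENNReal.ofReal_ne_top)
        (hd.smul_measure ENNReal.ofReal_ne_top), integral_smul_measure, integral_smul_measure,
        integral_dirac, ENNReal.toReal_ofReal (by linarith [ht.2]), ENNReal.toReal_ofReal ht.1.le]
      simp only [smul_eq_mul, hf, hg, mixtureDensity]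
      ring
    have h := hπ.2 hρmem
    simp only [Set.mem_ofPred_eq, logLik, hmix] at h
    have hn' : (0 : ℝ) < 1 / n := by positivity
    simpa [hφ, hf] using le_of_mul_le_mul_left h hn'
  have hderiv : HasDerivAt φ (∑ i, (g i - f i) / f i) 0 := by
    have h : ∀ i ∈ Finset.univ, HasDerivAt (fun t : ℝ => Real.log (f i + t * (g i - f i)))
        ((g i - f i) / f i) 0 := fun i _ => by
      have h1 : HasDerivAt (fun t : ℝ => f i + t * (g i - f i)) (g i - f i) 0 := by
        simpa using ((hasDerivAt_id (0 : ℝ)).mul_const (g i - f i)).const_add (f i)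
      simpa using h1.log (by simpa using (hfpos i).ne')
    exact HasDerivAt.fun_sum h
  have hslope := (hasDerivWithinAt_iff_tendsto_slope' (s := Set.Ioi (0 : ℝ)) (by simp)).1
    hderiv.hasDerivWithinAt
  have hnonpos : ∑ i, (g i - f i) / f i ≤ 0 := by
    refine le_of_tendsto hslope ?_
    filter_upwards [Ioo_mem_nhdsGT (zero_lt_one' ℝ)] with t ht
    rw [slope_def_field]
    exact div_nonpos_of_nonpos_of_nonneg (sub_nonpos.2 (hle t ht)) (by linarith [ht.1])
  have hsum : ∑ i, (g i - f i) / f i = ∑ i, g i / f i - n := by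
    have : ∀ i ∈ Finset.univ, (g i - f i) / f i = g i / f i - 1 := fun i _ => by
      rw [sub_div, div_self (hfpos i).ne']
    rw [Finset.sum_congr rfl this]
    simp
  linarith

/-- The directional derivatives `D θ - n` are not positive and have `π`-mean `0`, so they vanish
`π`-almost everywhere. -/
theorem IsNPMLE.ae_sum_density_div_eq {ν : Measure ℝ} {p₀ : ℝ → ℝ} {Θ : Set ℝ} {n : ℕ}
    (hn : 0 < n) {x : Fin n → ℝ} (hx : ∀ i, 0 < p₀ (x i)) {π : Measure ℝ}
    (hπ : IsNPMLE ν p₀ Θ x π) (hint : ∀ i, Integrable (fun θ => density ν p₀ θ (x i)) π) :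
    ∀ᵐ θ ∂π, ∑ i, density ν p₀ θ (x i) / mixtureDensity ν p₀ π (x i) = n := by
  have := hπ.1.1
  have hae : ∀ᵐ θ ∂π, θ ∈ Θ := hπ.1.2
  set D : ℝ → ℝ := fun θ => ∑ i, density ν p₀ θ (x i) / mixtureDensity ν p₀ π (x i) with hD
  have hDi : Integrable D π := integrable_finsetSum _ fun i _ => (hint i).div_const _
  have hDint : ∫ θ, D θ ∂π = n := by
    rw [integral_finsetSum _ fun i _ => (hint i).div_const _]
    have : ∀ i ∈ Finset.univ, ∫ θ, density ν p₀ θ (x i) / mixtureDensity ν p₀ π (x i) ∂π = 1 :=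
      fun i _ => by
        rw [integral_div]
        exact div_self (mixtureDensity_pos (hx i) (hint i)).ne'
    rw [Finset.sum_congr rfl this]
    simp
  have hnonneg : 0 ≤ᵐ[π] fun θ => (n : ℝ) - D θ := by
    filter_upwards [hae] with θ hθ
    exact sub_nonneg.2 (hπ.sum_density_div_le hn hx hint hθ)
  have hzero : ∫ θ, ((n : ℝ) - D θ) ∂π = 0 := by
    rw [integral_sub (integrable_const _) hDi, hDint]
    simp
  filter_upwards [(integral_eq_zero_iff_of_nonneg_ae hnonneg
    ((integrable_const _).sub hDi)).1 hzero] with θ hθ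
  simp only [Pi.zero_apply] at hθ
  linarith

/-- The optimality conditions in terms of the moment generating function `L`: some finite measure
`∑ Wᵢ δ_{xᵢ}` carried by the observations has a Laplace transform that is at most `L` on `Θ` and
equal to `L` almost everywhere for the estimator. -/
theorem IsNPMLE.exists_weights {ν : Measure ℝ} {p₀ : ℝ → ℝ} [NeZero (baseLaw ν p₀)] {Θ : Set ℝ}
    (hΘint : Θ ⊆ interior (integrableExpSet id (baseLaw ν p₀))) {n : ℕ}
    (hn : 0 < n) {x : Fin n → ℝ} (hx : ∀ i, 0 < p₀ (x i)) {π : Measure ℝ}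
    (hπ : IsNPMLE ν p₀ Θ x π) (hint : ∀ i, Integrable (fun θ => density ν p₀ θ (x i)) π) :
    ∃ W : Fin n → ℝ, (∀ i, 0 < W i) ∧
      (∀ θ ∈ Θ, ∑ i, W i * Real.exp (θ * x i) ≤ mgf id (baseLaw ν p₀) θ) ∧
      ∀ᵐ θ ∂π, ∑ i, W i * Real.exp (θ * x i) = mgf id (baseLaw ν p₀) θ := by
  have := hπ.1.1
  have hae : ∀ᵐ θ ∂π, θ ∈ Θ := hπ.1.2
  have hn' : (0 : ℝ) < n := by exact_mod_cast hn
  have hfpos : ∀ i, 0 < mixtureDensity ν p₀ π (x i) := fun i =>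
    mixtureDensity_pos (hx i) (hint i)
  have hrel : ∀ θ ∈ Θ, ∑ i, p₀ (x i) / (n * mixtureDensity ν p₀ π (x i)) * Real.exp (θ * x i) =
      mgf id (baseLaw ν p₀) θ / n *
        ∑ i, density ν p₀ θ (x i) / mixtureDensity ν p₀ π (x i) := fun θ hθ => by
    have hpos : 0 < mgf id (baseLaw ν p₀) θ := mgf_pos' (NeZero.ne _)
      (interior_subset (s := integrableExpSet id (baseLaw ν p₀)) (hΘint hθ))
    rw [Finset.mul_sum]
    refine Finset.sum_congr rfl fun i _ => ?_
    have := hfpos i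
    rw [density, kappa, L, Real.exp_sub, Real.exp_log hpos]
    field_simp
  refine ⟨fun i => p₀ (x i) / (n * mixtureDensity ν p₀ π (x i)),
    fun i => div_pos (hx i) (mul_pos hn' (hfpos i)), fun θ hθ => ?_, ?_⟩
  · rw [hrel θ hθ, div_mul_eq_mul_div, div_le_iff₀ hn']
    exact mul_le_mul_of_nonneg_left (hπ.sum_density_div_le hn hx hint hθ) mgf_nonneg
  · filter_upwards [hae, hπ.ae_sum_density_div_eq hn hx hint] with θ hθ h
    rw [hrel θ hθ, h, div_mul_cancel₀ _ hn'.ne']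

/-! ### The support of the NPMLE -/

/-- To the right of `u` each `exp (t * xᵢ)` with `xᵢ ≤ κ' u` grows more slowly than `exp (κ t)`, and
symmetrically to the left; so an inequality between the transforms at `u` becomes strict. -/
theorem sum_exp_lt_mgf {P : Measure ℝ} [NullSingletonClass P] [NeZero P] {ι : Type*} [Fintype ι]
    {W x : ι → ℝ} (hW : ∀ i, 0 ≤ W i) {u v : ℝ} (hu : u ∈ interior (integrableExpSet id P))
    (hv : v ∈ integrableExpSet id P) (huv : u ≠ v)
    (hle : ∑ i, W i * Real.exp (u * x i) ≤ mgf id P u)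
    (hslope : ∀ i, x i * (v - u) ≤ deriv (cgf id P) u * (v - u)) :
    ∑ i, W i * Real.exp (v * x i) < mgf id P v := by
  have hposu : 0 < mgf id P u :=
    mgf_pos' (NeZero.ne P) (interior_subset (s := integrableExpSet id P) hu)
  have hposv : 0 < mgf id P v := mgf_pos' (NeZero.ne P) hv
  calc ∑ i, W i * Real.exp (v * x i)
      ≤ ∑ i, Real.exp (deriv (cgf id P) u * (v - u)) * (W i * Real.exp (u * x i)) := by
        refine Finset.sum_le_sum fun i _ => ?_
        rw [mul_left_comm]
        refine mul_le_mul_of_nonneg_left ?_ (hW i)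
        rw [← Real.exp_add]
        exact Real.exp_le_exp.2 (by linarith [hslope i])
    _ ≤ Real.exp (deriv (cgf id P) u * (v - u)) * mgf id P u := by
        rw [← Finset.mul_sum]; gcongr
    _ = Real.exp (cgf id P u + deriv (cgf id P) u * (v - u)) := by
        rw [cgf, Real.exp_add, Real.exp_log hposu]; ring
    _ < Real.exp (cgf id P v) := Real.exp_lt_exp.2 (cgf_tangent_lt hu hv huv)
    _ = mgf id P v := by rw [cgf, Real.exp_log hposv]

/-- The two transforms touch at `t`, where their difference has a minimum, so their derivatives
agree. -/
theorem deriv_mgf_eq_sum {P : Measure ℝ} {ι : Type*} [Fintype ι] {W x : ι → ℝ} {Θ : Set ℝ}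
    (hΘ : IsOpen Θ) (hΘint : Θ ⊆ interior (integrableExpSet id P))
    (hle : ∀ θ ∈ Θ, ∑ i, W i * Real.exp (θ * x i) ≤ mgf id P θ) {t : ℝ} (ht : t ∈ Θ)
    (heq : mgf id P t = ∑ i, W i * Real.exp (t * x i)) :
    deriv (mgf id P) t = ∑ i, W i * (x i * Real.exp (t * x i)) := by
  have hE : HasDerivAt (fun θ => ∑ i, W i * Real.exp (θ * x i))
      (∑ i, W i * (x i * Real.exp (t * x i))) t := by
    refine HasDerivAt.fun_sum fun i _ => HasDerivAt.const_mul _ ?_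
    simpa [mul_comm] using ((hasDerivAt_id t).mul_const (x i)).exp
  have hd := (differentiableAt_mgf (hΘint ht)).hasDerivAt.sub hE
  have hmin : IsLocalMin (fun θ => mgf id P θ - ∑ i, W i * Real.exp (θ * x i)) t := by
    filter_upwards [hΘ.mem_nhds ht] with θ hθ
    rw [heq, sub_self]
    exact sub_nonneg.2 (hle θ hθ)
  exact sub_eq_zero.1 (hmin.hasDerivAt_eq_zero hd)

theorem support_subset {P π : Measure ℝ} [NullSingletonClass P] [NeZero P] {ι : Type*} [Fintype ι]
    {W x : ι → ℝ} (hW : ∀ i, 0 ≤ W i) {Θ : Set ℝ} (hΘint : Θ ⊆ interior (integrableExpSet id P))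
    {a b : ℝ} (hab : Set.Icc a b ⊆ Θ) (haΘ : a ∈ Θ) (hbΘ : b ∈ Θ)
    (ha : ∀ i, deriv (cgf id P) a ≤ x i) (hb : ∀ i, x i ≤ deriv (cgf id P) b)
    (hle : ∀ θ ∈ Θ, ∑ i, W i * Real.exp (θ * x i) ≤ mgf id P θ) (hπ : ∀ᵐ θ ∂π, θ ∈ Θ)
    (heq : ∀ᵐ θ ∂π, ∑ i, W i * Real.exp (θ * x i) = mgf id P θ) :
    π.support ⊆ {θ | θ ∈ Set.Icc a b ∧ mgf id P θ = ∑ i, W i * Real.exp (θ * x i)} := by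
  refine Measure.support_subset_of_isClosed ?_ ?_
  · have hcont : ContinuousOn (fun θ => mgf id P θ - ∑ i, W i * Real.exp (θ * x i))
        (Set.Icc a b) :=
      (continuousOn_mgf.mono (hab.trans hΘint)).sub (Continuous.continuousOn (by fun_prop))
    have := hcont.preimage_isClosed_of_isClosed isClosed_Icc (isClosed_singleton (x := (0 : ℝ)))
    convert! this using 1
    ext θ
    simp [sub_eq_zero]
  · filter_upwards [hπ, heq] with θ hθ h
    refine ⟨⟨?_, ?_⟩, h.symm⟩
    · by_contra! hlt
      refine (sum_exp_lt_mgf hW (hΘint haΘ) (interior_subset (hΘint hθ)) hlt.ne' (hle a haΘ)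
        fun i => ?_).ne h
      exact mul_le_mul_of_nonpos_right (ha i) (by linarith)
    · by_contra! hlt
      refine (sum_exp_lt_mgf hW (hΘint hbΘ) (interior_subset (hΘint hθ)) hlt.ne (hle b hbΘ)
        fun i => ?_).ne h
      exact mul_le_mul_of_nonneg_right (hb i) (by linarith)

theorem mem_interior_integrableExpSet_neg {P : Measure ℝ} {t : ℝ} :
    t ∈ interior (integrableExpSet (-id) P) ↔ -t ∈ interior (integrableExpSet id P) := by
  have h : integrableExpSet (-id) P = (Homeomorph.neg ℝ) ⁻¹' integrableExpSet id P := by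
    ext u
    simp [integrableExpSet]
  rw [h, ← Homeomorph.preimage_interior]
  rfl

/-- The counting estimate at the right end, and at the left end by the reflection `x ↦ -x`. -/
theorem card_mul_log_add_one_le_max {P : Measure ℝ} [NullSingletonClass P] [NeZero P]
    {ι : Type*} [Fintype ι] {W x : ι → ℝ} (hW : ∀ i, 0 ≤ W i) {xmin xmax : ℝ}
    (hxmin : ∀ i, xmin ≤ x i) (hxmax : ∀ i, x i ≤ xmax) (hx : xmin ≤ xmax) {a b δ : ℝ}
    (hab : a ≤ b) (hδ : 0 < δ)
    (hint : Set.Icc (a - 3 * δ) (b + 3 * δ) ⊆ interior (integrableExpSet id P))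
    (hle : ∀ θ ∈ Set.Icc (a - 3 * δ) (b + 3 * δ), ∑ i, W i * Real.exp (θ * x i) ≤ mgf id P θ)
    (ha : deriv (cgf id P) a = xmin) (hb : deriv (cgf id P) b = xmax)
    {T : Finset ℝ} (hT : Even T.card) (hTmem : ∀ t ∈ T, t ∈ Set.Icc a b)
    (h0 : ∀ t ∈ T, mgf id P t = ∑ i, W i * Real.exp (t * x i))
    (h1 : ∀ t ∈ T, deriv (mgf id P) t = ∑ i, W i * (x i * Real.exp (t * x i))) :
    T.card * Real.log ((b - a + 2 * δ) / (b - a + δ)) + 1 ≤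
        Real.log (1 / δ / (deriv (cgf id P) (b + δ) - xmax)) + cgf id P (b + 3 * δ) -
          cgf id P (b + δ) - xmin * (2 * δ) ∧
      T.card * Real.log ((b - a + 2 * δ) / (b - a + δ)) + 1 ≤
        Real.log (1 / δ / (xmin - deriv (cgf id P) (a - δ))) + cgf id P (a - 3 * δ) -
          cgf id P (a - δ) + xmax * (2 * δ) := by
  have hmem : ∀ {t}, a - 3 * δ ≤ t → t ≤ b + 3 * δ → t ∈ interior (integrableExpSet id P) :=
    fun h h' => hint ⟨h, h'⟩
  constructor
  · refine card_mul_log_add_one_le hW hxmin hxmax hx hT hab hTmem hδ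
      (fun t ht => hmem (by linarith [ht.1]) ht.2) h0 h1
      (hle _ ⟨by linarith, by linarith⟩) ?_
    rw [← hb]
    exact deriv_cgf_lt (hmem (by linarith) (by linarith)) (hmem (by linarith) (by linarith))
      (by linarith)
  · have hcgf : cgf (-id) P = fun t => cgf id P (-t) := funext fun t => cgf_neg
    have hmgf : mgf (-id) P = fun t => mgf id P (-t) := funext fun t => mgf_neg
    have hcard : (T.image Neg.neg).card = T.card := Finset.card_image_of_injective _ neg_injective
    have hexp : ∀ t i, Real.exp (t * -x i) = Real.exp (-t * x i) := fun t i => by ring_nf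
    have h := card_mul_log_add_one_le (P := P) (X := -id) (W := W) (ξ := fun i => -x i)
      (s := -xmax) (b := -xmin) hW (fun i => neg_le_neg (hxmax i)) (fun i => neg_le_neg (hxmin i))
      (neg_le_neg hx) (T := T.image Neg.neg) (by rwa [hcard]) (α := -b) (β := -a) (δ := δ)
      (neg_le_neg hab)
      (fun t ht => by
        obtain ⟨u, hu, rfl⟩ := Finset.mem_image.1 ht
        exact ⟨neg_le_neg (hTmem u hu).2, neg_le_neg (hTmem u hu).1⟩)
      hδ
      (fun t ht => mem_interior_integrableExpSet_neg.2
        (hmem (by linarith [ht.2]) (by linarith [ht.1])))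
      (fun t ht => by
        obtain ⟨u, hu, rfl⟩ := Finset.mem_image.1 ht
        simp only [hmgf, hexp, neg_neg, h0 u hu])
      (fun t ht => by
        obtain ⟨u, hu, rfl⟩ := Finset.mem_image.1 ht
        rw [hmgf, deriv_comp_neg]
        simp [h1 u hu])
      (by
        simp only [hmgf, hexp]
        exact hle _ ⟨by linarith, by linarith⟩)
      (by
        rw [hcgf, deriv_comp_neg, ← ha]
        exact neg_lt_neg (deriv_cgf_lt (hmem (by linarith) (by linarith))
          (hmem (by linarith) (by linarith)) (by linarith)))
    rw [hcard, hcgf, deriv_comp_neg] at h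
    beta_reduce at h
    rw [show -(-a + δ) = a - δ by ring, show -(-a + 3 * δ) = a - 3 * δ by ring,
      show -a - -b = b - a by ring] at h
    rw [show xmin - deriv (cgf id P) (a - δ) = -deriv (cgf id P) (a - δ) - -xmin by ring]
    linarith

/-! ### Counting -/

theorem log_ratio_le_one {c δ : ℝ} (hc : 0 ≤ c) (hδ : 0 < δ) :
    Real.log ((c + 2 * δ) / (c + δ)) ≤ 1 := by
  have h := Real.log_le_sub_one_of_pos (show 0 < (c + 2 * δ) / (c + δ) by positivity)
  have h2 : (c + 2 * δ) / (c + δ) ≤ 2 := by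
    rw [div_le_iff₀ (by positivity)]; linarith
  linarith

theorem exists_even_subset {α : Type*} (S : Finset α) :
    ∃ T ⊆ S, Even T.card ∧ S.card ≤ T.card + 1 := by
  obtain ⟨k, hk | hk⟩ := Nat.even_or_odd' S.card
  · exact ⟨S, subset_rfl, ⟨k, by omega⟩, by omega⟩
  · obtain ⟨T, hTS, hT⟩ := Finset.exists_subset_card_eq (s := S) (n := 2 * k) (by omega)
    exact ⟨T, hTS, ⟨k, by omega⟩, by omega⟩

theorem finite_and_ncard_le_of_forall_finset {α : Type*} {s : Set α} {K c : ℝ} (hc : 0 < c)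
    (h : ∀ S : Finset α, (S : Set α) ⊆ s → S.card * c ≤ K) :
    s.Finite ∧ (s.ncard : ℝ) ≤ K / c := by
  have hfin : s.Finite := by
    by_contra hinf
    obtain ⟨m, hm⟩ := exists_nat_gt (K / c)
    obtain ⟨S, hS, hcard⟩ := Set.Infinite.exists_subset_card_eq hinf m
    have := h S hS
    rw [hcard, ← le_div_iff₀ hc] at this
    linarith
  refine ⟨hfin, ?_⟩
  rw [le_div_iff₀ hc, Set.ncard_eq_toFinset_card s hfin]
  exact h _ (by simp)

end ExpFamily

theorem theorem2
    -- a continuous exponential family: base density `p₀` with respect to an atomless measure `ν`,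
    -- with finite moment generating function on an open interval around `0`
    (ν : MeasureTheory.Measure ℝ) [MeasureTheory.NullSingletonClass ν]
    (p₀ : ℝ → ℝ) (hp₀_meas : Measurable p₀) (hp₀_nonneg : ∀ x, 0 ≤ p₀ x)
    (hp₀_one : ∫⁻ x, ENNReal.ofReal (p₀ x) ∂ν = 1)
    (θlo θhi : EReal) (h0 : (0 : ℝ) ∈ ExpFamily.paramSpace θlo θhi)
    (hL : ∀ θ ∈ ExpFamily.paramSpace θlo θhi,
      MeasureTheory.Integrable (fun x : ℝ => Real.exp (θ * x)) (ExpFamily.baseLaw ν p₀))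
    -- the observations
    (n : ℕ) (hn : 0 < n) (x : Fin n → ℝ) (hx_pos : ∀ i, 0 < p₀ (x i))
    (xmin xmax : ℝ) (hxmin : ∀ i, xmin ≤ x i) (hxmax : ∀ i, x i ≤ xmax)
    -- `θmin = μ⁻¹(xmin)` and `θmax = μ⁻¹(xmax)`
    (θmin θmax : ℝ)
    (hθmin_mem : θmin ∈ ExpFamily.paramSpace θlo θhi)
    (hθmax_mem : θmax ∈ ExpFamily.paramSpace θlo θhi)
    (hθmin : ExpFamily.mean ν p₀ θmin = xmin)
    (hθmax : ExpFamily.mean ν p₀ θmax = xmax)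
    (hμ0 : xmin ≤ ExpFamily.mean ν p₀ 0 ∧ ExpFamily.mean ν p₀ 0 ≤ xmax)
    -- `0 < δ < min {θmin - θlo, θhi - θmax} / 5`
    (δ : ℝ) (hδ : 0 < δ)
    (hδlo : θlo < ((θmin - 5 * δ : ℝ) : EReal))
    (hδhi : ((θmax + 5 * δ : ℝ) : EReal) < θhi)
    (r : ℝ) (hr : r = (θmax - θmin) / 2)
    (πhat : MeasureTheory.Measure ℝ)
    (hπ : ExpFamily.IsNPMLE ν p₀ (ExpFamily.paramSpace θlo θhi) x πhat) :
    πhat.support.Finite ∧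
      (πhat.support.ncard : ℝ) ≤
        ExpFamily.N₁ ν p₀ xmin xmax θmin θmax δ /
          Real.log ((2 * r + 2 * δ) / (2 * r + δ)) := by
  open ExpFamily in
  set P := baseLaw ν p₀ with hP
  set Θ := paramSpace θlo θhi with hΘdef
  have hprob : IsProbabilityMeasure P :=
    ⟨by rw [hP, baseLaw, withDensity_apply _ MeasurableSet.univ, Measure.restrict_univ, hp₀_one]⟩
  have : NullSingletonClass P := by rw [hP, baseLaw]; infer_instance
  have hΘ : IsOpen Θ := isOpen_paramSpace θlo θhi
  have hΘint : Θ ⊆ interior (integrableExpSet id P) := paramSpace_subset_interior hL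
  have hmean : ∀ t, mean ν p₀ t = deriv (cgf id P) t := fun _ => rfl
  have hkappa : ∀ t, kappa ν p₀ t = cgf id P t := fun _ => rfl
  simp only [hmean] at hθmin hθmax hμ0
  have hmono : ∀ {u v}, u ∈ Θ → v ∈ Θ → deriv (cgf id P) u ≤ deriv (cgf id P) v → u ≤ v :=
    fun hu hv h => not_lt.1 fun h' => (deriv_cgf_lt (hΘint hv) (hΘint hu) h').not_ge h
  have hmin0 : θmin ≤ 0 := hmono hθmin_mem h0 (hθmin ▸ hμ0.1)
  have hmax0 : 0 ≤ θmax := hmono h0 hθmax_mem (hθmax ▸ hμ0.2)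
  have hloΘ : θmin - 3 * δ ∈ Θ :=
    ⟨hδlo.trans (EReal.coe_lt_coe_iff.2 (by linarith)),
      (EReal.coe_lt_coe_iff.2 (by linarith)).trans hθmin_mem.2⟩
  have hhiΘ : θmax + 3 * δ ∈ Θ :=
    ⟨hθmax_mem.1.trans (EReal.coe_lt_coe_iff.2 (by linarith)),
      (EReal.coe_lt_coe_iff.2 (by linarith)).trans hδhi⟩
  have hIcc : Set.Icc (θmin - 3 * δ) (θmax + 3 * δ) ⊆ Θ :=
    fun t ht => mem_paramSpace_of_mem_Icc hloΘ hhiΘ ht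
  have hdens : ∀ i, Integrable (fun θ => density ν p₀ θ (x i)) πhat := fun i => by
    obtain ⟨C, hC⟩ := exists_forall_mul_sub_cgf_le (hΘint hθmin_mem) (hΘint hθmax_mem)
      (hθmin.le.trans (hxmin i)) ((hxmax i).trans hθmax.ge)
    exact integrable_density hΘ hΘint (hx_pos i).le hC hπ.1
  obtain ⟨W, hWpos, hle, heq⟩ := hπ.exists_weights hΘint hn hx_pos hdens
  have hW : ∀ i, 0 ≤ W i := fun i => (hWpos i).le
  have hsupp := support_subset hW hΘint
    (fun t ht => mem_paramSpace_of_mem_Icc hθmin_mem hθmax_mem ht) hθmin_mem hθmax_mem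
    (fun i => hθmin.le.trans (hxmin i)) (fun i => (hxmax i).trans hθmax.ge) hle hπ.1.2 heq
  have h2r : 2 * r = θmax - θmin := by rw [hr]; ring
  rw [h2r]
  have hc : 0 ≤ θmax - θmin := by linarith
  refine finite_and_ncard_le_of_forall_finset (Real.log_pos ?_) fun S hS => ?_
  · rw [one_lt_div (by linarith)]; linarith
  obtain ⟨T, hTS, hTeven, hcard⟩ := exists_even_subset S
  have hTmem : ∀ t ∈ T, t ∈ Set.Icc θmin θmax ∧ mgf id P t = ∑ i, W i * Real.exp (t * x i) :=
    fun t ht => hsupp (hS (hTS ht))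
  have hmain := card_mul_log_add_one_le_max hW hxmin hxmax (hμ0.1.trans hμ0.2)
    (hmin0.trans hmax0) hδ (hIcc.trans hΘint) (fun t ht => hle t (hIcc ht)) hθmin hθmax hTeven
    (fun t ht => (hTmem t ht).1) (fun t ht => (hTmem t ht).2)
    (fun t ht => deriv_mgf_eq_sum hΘ hΘint hle
      (hIcc ⟨by linarith [(hTmem t ht).1.1], by linarith [(hTmem t ht).1.2]⟩) (hTmem t ht).2)
  -- dropping one point to make the number of nodes even costs at most `1`
  have hSle : S.card * Real.log ((θmax - θmin + 2 * δ) / (θmax - θmin + δ)) ≤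
      T.card * Real.log ((θmax - θmin + 2 * δ) / (θmax - θmin + δ)) + 1 := by
    have h1 := log_ratio_le_one hc hδ
    have h2 : 0 ≤ Real.log ((θmax - θmin + 2 * δ) / (θmax - θmin + δ)) :=
      Real.log_nonneg ((one_le_div (by linarith)).2 (by linarith))
    have h3 : (S.card : ℝ) ≤ T.card + 1 := by exact_mod_cast hcard
    nlinarith
  refine hSle.trans ?_
  have htangent : ∀ t ∈ Θ, deriv (cgf id P) 0 * t ≤ cgf id P t := fun t ht => by
    rcases eq_or_ne 0 t with rfl | h
    · simp
    · simpa using (cgf_tangent_lt (hΘint h0) (interior_subset (hΘint ht)) h).le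
  have hgap1 : 0 < deriv (cgf id P) (θmax + δ) - xmax := by
    rw [← hθmax, sub_pos]
    exact deriv_cgf_lt (hΘint hθmax_mem) (hΘint (hIcc ⟨by linarith, by linarith⟩)) (by linarith)
  have hgap2 : 0 < xmin - deriv (cgf id P) (θmin - δ) := by
    rw [← hθmin, sub_pos]
    exact deriv_cgf_lt (hΘint (hIcc ⟨by linarith, by linarith⟩)) (hΘint hθmin_mem) (by linarith)
  simp only [N₁, tau, hmean, hkappa]
  set μ₀ := deriv (cgf id P) 0 with hμ₀
  set A := max θmax (-θmin) with hA
  set B := max xmax (-xmin) with hB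
  have hA1 : θmax ≤ A := le_max_left _ _
  have hA2 : -θmin ≤ A := le_max_right _ _
  have hB0 : 0 ≤ B := by
    have h1 : xmax ≤ B := le_max_left _ _
    have h2 : -xmin ≤ B := le_max_right _ _
    linarith [hμ0.1.trans hμ0.2]
  set a := (xmax - xmin) / 2 with ha
  set x₀ := (xmax + xmin) / 2 with hx₀
  have ha0 : 0 ≤ a := by linarith [hμ0.1.trans hμ0.2]
  have hx₀1 := le_abs_self x₀
  have hx₀2 := neg_abs_le x₀
  have hmul : ∀ t, |t| ≤ A + δ → -(μ₀ * t) ≤ |μ₀| * (A + δ) := fun t ht => by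
    refine (neg_le_abs _).trans ?_
    rw [abs_mul]
    exact mul_le_mul_of_nonneg_left ht (abs_nonneg _)
  -- the linear terms of the estimate are dominated by those of `N₁`
  have hlin : |μ₀| * (A + δ) + (a + |x₀|) * (2 * δ) ≤ 2 * (a + |μ₀| + |x₀|) * (A + 2 * δ) := by
    have hA0 : 0 ≤ A := hmax0.trans hA1
    nlinarith [mul_nonneg (abs_nonneg μ₀) hA0, mul_nonneg (abs_nonneg μ₀) hδ.le,
      mul_nonneg ha0 hA0, mul_nonneg (abs_nonneg x₀) hA0, mul_nonneg ha0 hδ.le,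
      mul_nonneg (abs_nonneg x₀) hδ.le]
  have hlog : ∀ τ, 0 < τ → Real.log (1 / δ / τ) ≤ Real.log ((B + 1 / δ) / τ) := fun τ hτ =>
    Real.log_le_log (by positivity) (by gcongr; linarith)
  rcases le_total (xmin - deriv (cgf id P) (θmin - δ)) (deriv (cgf id P) (θmax + δ) - xmax)
    with h | h
  · rw [max_eq_left h]
    have h1 := hlog _ hgap1
    have h2 := htangent (θmax + δ) (hIcc ⟨by linarith, by linarith⟩)
    have h3 := hmul (θmax + δ) (by rw [abs_of_nonneg (by linarith)]; linarith)
    have h4 := le_max_right (cgf id P (θmin - 3 * δ)) (cgf id P (θmax + 3 * δ))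
    have h5 : -xmin * (2 * δ) ≤ (a + |x₀|) * (2 * δ) :=
      mul_le_mul_of_nonneg_right (by linarith) (by linarith)
    linarith [hmain.1]
  · rw [max_eq_right h]
    have h1 := hlog _ hgap2
    have h2 := htangent (θmin - δ) (hIcc ⟨by linarith, by linarith⟩)
    have h3 := hmul (θmin - δ) (by rw [abs_of_nonpos (by linarith)]; linarith)
    have h4 := le_max_left (cgf id P (θmin - 3 * δ)) (cgf id P (θmax + 3 * δ))
    have h5 : xmax * (2 * δ) ≤ (a + |x₀|) * (2 * δ) :=
      mul_le_mul_of_nonneg_right (by linarith) (by linarith)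
    linarith [hmain.2]
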